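/- Let $R$ be a commutative unital $*$-algebra, that is, a commutative unital $\mathbb{C}$-algebra with an involution $*$ satisfying $(\lambda a)^*=\overline{\lambda}a^*$, $(a+b)^*=a^*+b^*$, $(ab)^*=a^*b^*$ and $a^{**}=a$ for all $\lambda\in\mathbb{C}$ and $a,b\in R$. Let $\varphi:R\to[0,\infty)$ be a submultiplicative $*$-seminorm, that is, $\varphi(\lambda a)=|\lambda|\varphi(a)$, $\varphi(a+b)\le\varphi(a)+\varphi(b)$, $\varphi(ab)\le\varphi(a)\varphi(b)$ and $\varphi(a^*)=\varphi(a)$ for all $\lambda\in\mathbb{C}$ and $a,b\in R$. Let $H(R)=\{a\in R: a^*=a\}$ be the symmetric part of $R$, let $d\ge 1$ be an integer, and let $S\subseteq H(R)$ be a $\sum H(R)^{2d}$-module of $H(R)$, that is, $1\in S$, $S+S\subseteq S$, and $a^{2d}S\subseteq S$ for each $a\in H(R)$. Let $\mathcal{V}_R$ be the set of all unital $*$-algebra homomorphisms $\alpha:R\to\mathbb{C}$, with the topology of a subspace of the product space $\mathbb{C}^R$. For $a\in R$ let $\hat a:\mathcal{V}_R\to\mathbb{C}$, $\hat a(\alpha)=\alpha(a)$.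 Let $\mathcal{M}_\varphi\subseteq\mathcal{V}_R$ be the set of all $\varphi$-continuous $\alpha\in\mathcal{V}_R$, let $\mathcal{K}_S=\{\alpha\in\mathcal{V}_R:\hat a(\alpha)\ge 0\text{ for all }a\in S\}$, and for $K\subseteq\mathcal{V}_R$ let $\mathrm{Pos}(K)=\{a\in H(R):\hat a(\alpha)\ge 0\text{ for all }\alpha\in K\}$. A Radon measure on $\mathcal{V}_R$ is a measure on the Borel $\sigma$-algebra of $\mathcal{V}_R$ that is locally finite and inner regular (every Borel set can be approximated in measure from within by compact sets). Then the closure $\overline{S}^{\varphi}$ of $S$ in $H(R)$, in the topology induced by $\varphi$, is $$\overline{S}^{\varphi}=\mathrm{Pos}(\mathcal{K}_S\cap\mathcal{M}_\varphi).$$ Moreover, if $L:R\to\mathbb{C}$ is any $\varphi$-continuous $*$-linear functional (a $\mathbb{C}$-linear map with $L(a^*)=\overline{L(a)}$ for all $a\in R$) such that $L(s)\ge 0$ for all $s\in S$, then there exists a unique Radon measure $\mu$ on $\mathcal{V}_R$ such that, for all $a\in R$, $\hat a$ is $\mu$-integrable and $L(a)=\int\hat a\,d\mu$; and this measure satisfies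 $\mathrm{supp}(\mu)\subseteq\mathcal{K}_S\cap\mathcal{M}_\varphi$. -/

import Mathlib

open MeasureTheory Topology
open scoped ComplexOrder

namespace StarMoment

/-- `S` is a `∑ A^{2d}`-module of the commutative unital ring `A`:
`1 ∈ S`, `S + S ⊆ S`, and `a ^ (2 * d) • S ⊆ S` for every `a ∈ A`. -/
structure IsEvenPowerModule {A : Type*} [CommRing A] (d : ℕ) (S : Set A) : Prop where
  one_mem : (1 : A) ∈ S
  add_mem : ∀ s ∈ S, ∀ t ∈ S, s + t ∈ S
  pow_mul_mem : ∀ a : A, ∀ s ∈ S, a ^ (2 * d) * s ∈ S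

/-- A Radon measure on a (Hausdorff) space with its Borel `σ`-algebra: a locally finite measure
such that every Borel set is approximated from within by compact sets. -/
structure IsRadon {X : Type*} [TopologicalSpace X] [MeasurableSpace X] (μ : Measure X) : Prop where
  locallyFinite : IsLocallyFiniteMeasure μ
  innerRegular : μ.InnerRegular

/-- A submultiplicative `*`-seminorm on a commutative unital complex `*`-algebra. -/
structure IsSubmulStarSeminorm {R : Type*} [CommRing R] [StarRing R] [Algebra ℂ R]
    (φ : Seminorm ℂ R) : Prop where
  mul_le : ∀ a b : R, φ (a * b) ≤ φ a * φ b
  star_eq : ∀ a : R, φ (star a) = φ a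

/-- The topology on `R` defined by the pseudometric `(a, b) ↦ φ (a - b)`. -/
@[reducible]
def seminormTopology {R : Type*} [CommRing R] [Algebra ℂ R] (φ : Seminorm ℂ R) :
    TopologicalSpace R :=
  φ.toAddGroupSeminorm.toSeminormedAddCommGroup.toPseudoMetricSpace.toUniformSpace.toTopologicalSpace

/-- The set `V_R` of all (unital) `*`-algebra homomorphisms `R → ℂ`. -/
abbrev Char (R : Type*) [CommRing R] [StarRing R] [Algebra ℂ R] : Type _ := R →⋆ₐ[ℂ] ℂ

section

variable {R : Type*} [CommRing R] [StarRing R] [Algebra ℂ R]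

/-- The topology of `V_R` as a subspace of the product space `ℂ ^ R`. -/
noncomputable instance charTopology : TopologicalSpace (Char R) :=
  TopologicalSpace.induced (fun (α : Char R) (a : R) => α a) Pi.topologicalSpace

noncomputable instance charMeasurableSpace : MeasurableSpace (Char R) := borel (Char R)

noncomputable instance charBorelSpace : BorelSpace (Char R) := ⟨rfl⟩

/-- The nonnegativity set `K_S` of a set `S` of symmetric elements. (In the order on `ℂ` used here,
`0 ≤ z` says that `z` is real and nonnegative.) -/
def nonnegSet (S : Set (selfAdjoint R)) : Set (Char R) :=
  {α | ∀ a ∈ S, 0 ≤ α (a : R)}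

/-- `Pos(K)`: the symmetric elements that are nonnegative on `K ⊆ V_R`. -/
def posSet (K : Set (Char R)) : Set (selfAdjoint R) :=
  {a | ∀ α ∈ K, 0 ≤ α (a : R)}

/-- The Gelfand spectrum `M_φ`: all `φ`-continuous elements of `V_R`. -/
def gelfandSpectrum (φ : Seminorm ℂ R) : Set (Char R) :=
  {α | Continuous[seminormTopology φ, inferInstance] (fun a : R => α a)}

/-- The closure of `S` in the symmetric part `H(R)`, in the topology induced by `φ`. -/
def symmClosure (φ : Seminorm ℂ R) (S : Set (selfAdjoint R)) : Set (selfAdjoint R) :=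
  @closure (selfAdjoint R) (TopologicalSpace.induced Subtype.val (seminormTopology φ)) S

/-- `μ` represents `L`: every evaluation `â : α ↦ α a` is integrable, and `L a = ∫ â dμ`. -/
def Represents (μ : Measure (Char R)) (L : R →ₗ[ℂ] ℂ) : Prop :=
  ∀ a : R, Integrable (fun α : Char R => α a) μ ∧ L a = ∫ α : Char R, α a ∂μ

end

end StarMoment

namespace StarMoment

/-! ### Scalar multiples in even power modules. -/

section Ring

variable {A : Type*} [CommRing A] [Algebra ℝ A] {d : ℕ} {S : Set A}

/-! View `H(R)` as a real seminormed algebra. In its completion every element near `1` is a `2d`-th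
power, so a closed module is stable under multiplication by `1 + a` for small `a`. Hence functionals
nonnegative on it are bounded by a fixed multiple of their value at `1`, and the normalized ones
(states) form a compact convex set. Splitting a state as half of `f((1 + ca)·)` plus half of `f((1 -
ca)·)` shows that extreme states are multiplicative. Hahn–Banach and Krein–Milman then separate a
point outside the module by a character (`exists_algHom_neg`), which gives the closure formula.

By that formula, `L` is nonnegative on `Pos(K)` for the compact set `K = K_S ∩ M_φ`; the M. Riesz
extension and Riesz–Markov theorems yield a measure carried by `K`. For uniqueness, the growth of
the moments of `(a* a)^n` confines every representing Radon measure to the compact set `M_φ`, where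
Stone–Weierstrass applies. -/

theorem IsEvenPowerModule.smul_mem (hS : IsEvenPowerModule d S) (hd : 1 ≤ d) {r : ℝ} (hr : 0 ≤ r)
    {s : A} (hs : s ∈ S) : r • s ∈ S := by
  have h := hS.pow_mul_mem (algebraMap ℝ A (r ^ ((2 * d : ℕ) : ℝ)⁻¹)) s hs
  rwa [← map_pow, Real.rpow_inv_natCast_pow hr (by lia), ← Algebra.smul_def] at h

theorem IsEvenPowerModule.zero_mem (hS : IsEvenPowerModule d S) (hd : 1 ≤ d) : (0 : A) ∈ S := by
  simpa using hS.smul_mem hd le_rfl hS.one_mem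

end Ring

/-! ### Closed modules, states and separating characters. -/

section Seminormed

variable {A : Type*} [SeminormedCommRing A] [NormedAlgebra ℝ A] {d : ℕ} {S : Set A}

omit [NormedAlgebra ℝ A] in
theorem IsEvenPowerModule.topologicalClosure (hS : IsEvenPowerModule d S) :
    IsEvenPowerModule d (closure S) where
  one_mem := subset_closure hS.one_mem
  add_mem _ hs _ ht := map_mem_closure₂ continuous_add hs ht hS.add_mem
  pow_mul_mem a _ hs := map_mem_closure (continuous_const.mul continuous_id) hs
    (fun s hs => hS.pow_mul_mem a s hs)

/-- Elements close to `1` in a complete algebra are `n`-th powers. -/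
theorem eventually_exists_pow_eq {B : Type*} [NormedCommRing B] [NormedAlgebra ℝ B]
    [CompleteSpace B] {n : ℕ} (hn : n ≠ 0) : ∀ᶠ x in 𝓝 (1 : B), ∃ b : B, b ^ n = x := by
  have h := hasStrictFDerivAt_pow (𝕜 := ℝ) n (x := (1 : B))
  -- The derivative at `1` is multiplication by `n`, which is onto, so the power map sends
  -- neighbourhoods of `1` onto neighbourhoods of `1`.
  have h2 := h.map_nhds_eq_of_surj (by
    rw [LinearMap.range_eq_top]
    intro y
    refine ⟨(n : ℝ)⁻¹ • y, ?_⟩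
    have : (n : ℝ) ≠ 0 := by exact_mod_cast hn
    simp only [one_pow, ContinuousLinearMap.coe_coe, smul_apply,
      ContinuousLinearMap.id_apply]
    simp [← Nat.cast_smul_eq_nsmul ℝ, smul_smul, this])
  rw [one_pow] at h2
  rw [← h2, Filter.eventually_map]
  exact Filter.Eventually.of_forall fun b => ⟨b, rfl⟩

/-- Take the root in the completion and approximate it by elements of `A`. -/
theorem exists_one_add_mem_closure_pow {n : ℕ} (hn : n ≠ 0) :
    ∃ ε > 0, ∀ a : A, ‖a‖ < ε → 1 + a ∈ closure (Set.range fun b : A => b ^ n) := by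
  obtain ⟨ε, hε, h⟩ := Metric.eventually_nhds_iff.1
    (eventually_exists_pow_eq (B := UniformSpace.Completion A) hn)
  refine ⟨ε, hε, fun a ha => ?_⟩
  obtain ⟨b, hb⟩ := h (y := ((1 + a : A) : UniformSpace.Completion A)) (by
    rw [dist_eq_norm, UniformSpace.Completion.coe_add, UniformSpace.Completion.coe_one]
    simpa using ha)
  rw [(UniformSpace.Completion.isUniformInducing_coe A).isInducing.closure_eq_preimage_closure_image]
  rw [Set.mem_preimage, ← hb]
  have hb' : b ∈ closure (Set.range ((↑) : A → UniformSpace.Completion A)) :=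
    UniformSpace.Completion.denseRange_coe b
  refine map_mem_closure (f := fun x => x ^ n) (continuous_pow n) hb' ?_
  rintro _ ⟨c, rfl⟩
  exact ⟨c ^ n, ⟨c, rfl⟩, map_pow (UniformSpace.Completion.coeRingHom (α := A)) c n⟩

theorem IsEvenPowerModule.exists_one_add_mul_mem (hS : IsEvenPowerModule d S) (hd : 1 ≤ d)
    (hc : IsClosed S) : ∃ ε > 0, ∀ a : A, ‖a‖ < ε → ∀ s ∈ S, (1 + a) * s ∈ S := by
  obtain ⟨ε, hε, h⟩ := exists_one_add_mem_closure_pow (A := A) (n := 2 * d) (by lia)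
  refine ⟨ε, hε, fun a ha s hs => ?_⟩
  rw [← hc.closure_eq]
  refine map_mem_closure (f := fun x => x * s) (by fun_prop) (h a ha) ?_
  rintro _ ⟨b, rfl⟩
  exact hS.pow_mul_mem b s hs

/-- Functionals that are nonnegative on a closed module are bounded by their value at `1`. -/
theorem IsEvenPowerModule.exists_abs_le (hS : IsEvenPowerModule d S) (hd : 1 ≤ d)
    (hc : IsClosed S) : ∃ C > 0, ∀ f : A →ₗ[ℝ] ℝ, (∀ s ∈ S, 0 ≤ f s) →
      ∀ a, |f a| ≤ C * ‖a‖ * f 1 := by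
  obtain ⟨ε, hε, h⟩ := hS.exists_one_add_mul_mem hd hc
  refine ⟨2 / ε, by positivity, fun f hf a => ?_⟩
  have h1 : 0 ≤ f 1 := hf 1 hS.one_mem
  -- The slack `η` avoids division by zero, since `‖a‖` may vanish.
  have key : ∀ η > 0, |f a| ≤ 2 / ε * (‖a‖ + η) * f 1 := by
    intro η hη
    have ht : 0 < ‖a‖ + η := by positivity
    have hb : ∀ r : ℝ, |r| = ε / 2 / (‖a‖ + η) → 0 ≤ f 1 + r * f a := by
      intro r hr
      have h2 := hf _ (h (r • a) (by
        rw [norm_smul, Real.norm_eq_abs, hr, div_mul_eq_mul_div, div_lt_iff₀ ht]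
        nlinarith [norm_nonneg a]) 1 hS.one_mem)
      simpa using h2
    have hp := hb (ε / 2 / (‖a‖ + η)) (abs_of_pos (by positivity))
    have hm := hb (-(ε / 2 / (‖a‖ + η))) (by rw [abs_neg, abs_of_pos (by positivity)])
    have : |f a| * (ε / 2 / (‖a‖ + η)) ≤ f 1 := by
      rcases abs_cases (f a) with ⟨h, -⟩ | ⟨h, -⟩ <;> rw [h] <;> linarith
    calc |f a| = 2 / ε * (‖a‖ + η) * (|f a| * (ε / 2 / (‖a‖ + η))) := by field_simp
      _ ≤ _ := by gcongr
  have hlim : Filter.Tendsto (fun η : ℝ => 2 / ε * (‖a‖ + η) * f 1) (𝓝[>] 0)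
      (𝓝 (2 / ε * (‖a‖ + 0) * f 1)) :=
    (Continuous.tendsto (by fun_prop) 0).mono_left nhdsWithin_le_nhds
  rw [add_zero] at hlim
  exact ge_of_tendsto hlim (Filter.eventually_of_mem self_mem_nhdsWithin key)

/-- The linear functionals that are nonnegative on `S` and normalized at `1`, as a set of plain
functions with the topology of pointwise convergence. -/
def stateSet (S : Set A) : Set (A → ℝ) :=
  {f | (∀ x y, f (x + y) = f x + f y) ∧ (∀ (r : ℝ) x, f (r • x) = r * f x) ∧ f 1 = 1 ∧
    ∀ s ∈ S, 0 ≤ f s}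

theorem coe_mem_stateSet {f : A →ₗ[ℝ] ℝ} (h1 : f 1 = 1) (hf : ∀ s ∈ S, 0 ≤ f s) :
    ⇑f ∈ stateSet S :=
  ⟨map_add f, fun r x => by simp, h1, hf⟩

theorem exists_linearMap_of_mem_stateSet {f : A → ℝ} (hf : f ∈ stateSet S) :
    ∃ g : A →ₗ[ℝ] ℝ, ⇑g = f ∧ g 1 = 1 ∧ ∀ s ∈ S, 0 ≤ g s :=
  ⟨{ toFun := f, map_add' := hf.1, map_smul' := hf.2.1 }, rfl, hf.2.2⟩

theorem isClosed_stateSet (S : Set A) : IsClosed (stateSet S) := by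
  simp only [stateSet, Set.ofPred_and, Set.ofPred_forall]
  refine .inter ?_ (.inter ?_ (.inter ?_ ?_))
  · exact isClosed_iInter fun x => isClosed_iInter fun y => isClosed_eq (by fun_prop) (by fun_prop)
  · exact isClosed_iInter fun x => isClosed_iInter fun y => isClosed_eq (by fun_prop) (by fun_prop)
  · exact isClosed_eq (by fun_prop) (by fun_prop)
  · exact isClosed_iInter fun x => isClosed_iInter fun _ =>
      isClosed_le (by fun_prop) (by fun_prop)

theorem convex_stateSet (S : Set A) : Convex ℝ (stateSet S) := by
  rintro f ⟨f1, f2, f3, f4⟩ g ⟨g1, g2, g3, g4⟩ p q hp hq hpq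
  refine ⟨fun x y => ?_, fun r x => ?_, ?_, fun s hs => ?_⟩ <;>
    simp only [Pi.add_apply, Pi.smul_apply, smul_eq_mul]
  · rw [f1, g1]; ring
  · rw [f2, g2]; ring
  · rw [f3, g3]; linarith
  · have := f4 s hs
    have := g4 s hs
    positivity

/-- The uniform bound places the states in a product of compact intervals, so Tychonoff applies. -/
theorem IsEvenPowerModule.isCompact_stateSet (hS : IsEvenPowerModule d S) (hd : 1 ≤ d)
    (hc : IsClosed S) : IsCompact (stateSet S) := by
  obtain ⟨C, -, h⟩ := hS.exists_abs_le hd hc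
  refine (isCompact_univ_pi fun a : A => isCompact_Icc (a := -(C * ‖a‖)) (b := C * ‖a‖)).of_isClosed_subset
    (isClosed_stateSet S) fun f hf a _ => ?_
  obtain ⟨g, rfl, h1, hg⟩ := exists_linearMap_of_mem_stateSet hf
  have := h g hg a
  rw [h1, mul_one] at this
  exact abs_le.1 this

/-- Extreme points of the state space are multiplicative. -/
theorem IsEvenPowerModule.map_mul_of_mem_extremePoints (hS : IsEvenPowerModule d S) (hd : 1 ≤ d)
    (hc : IsClosed S) {f : A → ℝ} (hf : f ∈ (stateSet S).extremePoints ℝ) (a x : A) :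
    f (a * x) = f a * f x := by
  obtain ⟨hfS, hext⟩ := hf
  obtain ⟨f, rfl, h1, hf⟩ := exists_linearMap_of_mem_stateSet hfS
  obtain ⟨C, -, hC⟩ := hS.exists_abs_le hd hc
  obtain ⟨ε, hε, h⟩ := hS.exists_one_add_mul_mem hd hc
  obtain ⟨c, hc0, hca⟩ : ∃ c : ℝ, 0 < c ∧ c * ‖a‖ < ε := by
    refine ⟨ε / 2 / (‖a‖ + 1), by positivity, ?_⟩
    rw [div_mul_eq_mul_div, div_lt_iff₀ (by positivity)]
    nlinarith [norm_nonneg a]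
  have hmul : ∀ r : ℝ, |r| = c → ∀ s ∈ S, (1 / 2 : ℝ) • ((1 + r • a) * s) ∈ S := fun r hr s hs =>
    hS.smul_mem hd (by norm_num) (h _ (by rwa [norm_smul, Real.norm_eq_abs, hr]) s hs)
  -- `F c + F (-c) = f`, and both summands are nonnegative on `S`; extremality will make `F c`
  -- proportional to `f`.
  let F (r : ℝ) : A →ₗ[ℝ] ℝ := (1 / 2 : ℝ) • f ∘ₗ LinearMap.mulLeft ℝ (1 + r • a)
  have hF : ∀ r y, F r y = 1 / 2 * (f y + r * f (a * y)) := by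
    intro r y
    simp [F, add_mul]
  have hFS : ∀ r : ℝ, |r| = c → ∀ s ∈ S, 0 ≤ F r s := fun r hr s hs => by
    have := hf _ (hmul r hr s hs)
    rw [hF]
    simpa [add_mul, mul_add] using this
  have hc1 : |c| = c := abs_of_pos hc0
  have hc2 : |-c| = c := by rw [abs_neg, hc1]
  have hF1 : ∀ r, F r 1 = 1 / 2 * (1 + r * f a) := fun r => by rw [hF, h1, mul_one]
  have hzero : ∀ r : ℝ, |r| = c → F r 1 = 0 → F r x = 0 := fun r hr h0 => by
    have := hC (F r) (hFS r hr) x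
    rw [h0, mul_zero] at this
    exact abs_nonpos_iff.1 this
  have hFc : F c x = F c 1 * f x := by
    -- A summand vanishing at `1` cannot be normalized, but the bound makes it vanish at `x` too.
    rcases (hFS c hc1 1 hS.one_mem).eq_or_lt with hp | hp
    · rw [hzero c hc1 hp.symm, ← hp, zero_mul]
    rcases (hFS (-c) hc2 1 hS.one_mem).eq_or_lt with hq | hq
    · have h3 := hzero (-c) hc2 hq.symm
      rw [hF1] at hq ⊢
      rw [hF] at h3 ⊢
      linear_combination (-1 : ℝ) * h3 - f x * hq
    have hst : ∀ r : ℝ, |r| = c → 0 < F r 1 → ⇑((F r 1)⁻¹ • F r) ∈ stateSet S := fun r hr hr1 =>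
      coe_mem_stateSet (by simp [hr1.ne']) fun s hs => by
        have := hFS r hr s hs
        simp only [LinearMap.smul_apply, smul_eq_mul]
        positivity
    have heq := hext (hst c hc1 hp) (hst (-c) hc2 hq) ⟨F c 1, F (-c) 1, hp, hq, by
      rw [hF1, hF1]; ring, by
      ext y
      simp only [Pi.add_apply, Pi.smul_apply, LinearMap.coe_smul, smul_eq_mul]
      rw [mul_inv_cancel_left₀ hp.ne', mul_inv_cancel_left₀ hq.ne', hF, hF]
      ring⟩
    have := congrFun heq x
    simp only [LinearMap.coe_smul, Pi.smul_apply, smul_eq_mul] at this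
    rw [← this, mul_inv_cancel_left₀ hp.ne']
  rw [hF1, hF] at hFc
  have : c * f (a * x) = c * (f a * f x) := by linear_combination 2 * hFc
  exact mul_left_cancel₀ hc0.ne' this

/-- A point outside a closed module is separated from it by a character. -/
theorem IsEvenPowerModule.exists_algHom_neg (hS : IsEvenPowerModule d S) (hd : 1 ≤ d)
    (hc : IsClosed S) {a : A} (ha : a ∉ S) :
    ∃ f : A →ₐ[ℝ] ℝ, Continuous f ∧ (∀ s ∈ S, 0 ≤ f s) ∧ f a < 0 := by
  have hconv : Convex ℝ S := fun x hx y hy p q hp hq _ =>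
    hS.add_mem _ (hS.smul_mem hd hp hx) _ (hS.smul_mem hd hq hy)
  obtain ⟨C, hC0, hC⟩ := hS.exists_abs_le hd hc
  obtain ⟨g, u, hgu, hg⟩ := geometric_hahn_banach_point_closed hconv hc ha
  have hu : u < 0 := by simpa using hg 0 (hS.zero_mem hd)
  have hgS : ∀ s ∈ S, 0 ≤ g s := by
    intro s hs
    by_contra! hneg
    -- This multiple of `s` lies in `S` and has `g`-value exactly `u`, contradicting strict
    -- separation.
    have := hg ((u / g s) • s) (hS.smul_mem hd (div_nonneg_of_nonpos hu.le hneg.le) hs)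
    rw [map_smul, smul_eq_mul, div_mul_cancel₀ _ hneg.ne] at this
    exact this.false
  have hga : g a < 0 := hgu.trans hu
  have hg1 : 0 < g 1 := by
    refine (hgS 1 hS.one_mem).lt_of_ne fun h0 => ?_
    have := hC g.toLinearMap hgS a
    simp only [ContinuousLinearMap.coe_coe, ← h0, mul_zero] at this
    rw [abs_nonpos_iff.1 this] at hga
    exact hga.false
  have hmem : ⇑((g 1)⁻¹ • g.toLinearMap) ∈ stateSet S :=
    coe_mem_stateSet (by simp [hg1.ne']) fun s hs => by
      have := hgS s hs
      simp only [LinearMap.smul_apply, smul_eq_mul, ContinuousLinearMap.coe_coe]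
      positivity
  obtain ⟨f, hf, hfa⟩ : ∃ f ∈ (stateSet S).extremePoints ℝ, f a < 0 := by
    -- By Krein–Milman, nonnegativity at `a` would pass from the extreme states to all states,
    -- including the normalized `g`.
    by_contra! hall
    have hsub : closure (convexHull ℝ ((stateSet S).extremePoints ℝ)) ⊆ {f | 0 ≤ f a} := by
      refine closure_minimal (convexHull_min hall ?_) (isClosed_le (by fun_prop) (by fun_prop))
      exact convex_halfSpace_ge (LinearMap.proj (R := ℝ) (φ := fun _ : A => ℝ) a).isLinear 0
    rw [closure_convexHull_extremePoints (hS.isCompact_stateSet hd hc) (convex_stateSet S)] at hsub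
    have h2 := hsub hmem
    simp only [Set.mem_ofPred_eq, LinearMap.coe_smul, Pi.smul_apply, ContinuousLinearMap.coe_coe,
      smul_eq_mul] at h2
    exact (mul_neg_of_pos_of_neg (inv_pos.2 hg1) hga).not_ge h2
  have hmul := hS.map_mul_of_mem_extremePoints hd hc hf
  obtain ⟨f, rfl, h1, hfS⟩ := exists_linearMap_of_mem_stateSet hf.1
  refine ⟨AlgHom.ofLinearMap f h1 hmul, ?_, hfS, hfa⟩
  refine AddMonoidHomClass.continuous_of_bound f C fun x => ?_
  have := hC f hfS x
  rwa [h1, mul_one] at this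

end Seminormed

end StarMoment

namespace StarMoment

/-! ### Characters of `R` and of its symmetric part. -/

section Character

variable {R : Type*} [CommRing R] [StarRing R] [Algebra ℂ R]

theorem continuous_char_apply (a : R) : Continuous fun α : Char R => α a :=
  (continuous_apply a).comp continuous_induced_dom

instance : T2Space (Char R) :=
  T2Space.of_injective_continuous (f := fun (α : Char R) (a : R) => α a)
    (fun _ _ h => DFunLike.ext _ _ (congrFun h)) continuous_induced_dom

theorem ofReal_re_char_apply (α : Char R) (a : selfAdjoint R) :
    (((α (a : R)).re : ℝ) : ℂ) = α (a : R) := by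
  rw [← Complex.conj_eq_iff_re, ← Complex.star_def, ← map_star, a.2.star_eq]

theorem nonneg_char_apply_iff (α : Char R) (a : selfAdjoint R) :
    0 ≤ α (a : R) ↔ 0 ≤ (α (a : R)).re := by
  rw [← ofReal_re_char_apply, Complex.ofReal_re, Complex.zero_le_real]

variable [StarModule ℂ R]

noncomputable instance selfAdjointAlgebra : Algebra ℝ (selfAdjoint R) :=
  Algebra.ofModule (fun r x y => Subtype.ext (by simp))
    (fun r x y => Subtype.ext (by simp))

open ComplexStarModule in
theorem realPart_mul (a b : R) : ℜ (a * b) = ℜ a * ℜ b - ℑ a * ℑ b := by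
  have h : a * b = ((ℜ a * ℜ b - ℑ a * ℑ b : selfAdjoint R) : R) +
      Complex.I • ((ℜ a * ℑ b + ℑ a * ℜ b : selfAdjoint R) : R) := by
    conv_lhs => rw [← realPart_add_I_smul_imaginaryPart a, ← realPart_add_I_smul_imaginaryPart b]
    simp only [add_mul, mul_add, smul_mul_assoc, mul_smul_comm, smul_smul, Complex.I_mul_I,
      AddSubgroupClass.coe_sub, selfAdjoint.val_mul, AddMemClass.coe_add, smul_add, neg_smul,
      one_smul]
    abel
  rw [h, map_add, selfAdjoint.realPart_coe, realPart_I_smul, selfAdjoint.imaginaryPart_coe,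
    neg_zero, add_zero]

open ComplexStarModule in
theorem imaginaryPart_mul (a b : R) : ℑ (a * b) = ℜ a * ℑ b + ℑ a * ℜ b := by
  have h := realPart_mul (-Complex.I • a) b
  rw [smul_mul_assoc] at h
  simpa [realPart_I_smul, imaginaryPart_I_smul, add_comm] using h

open ComplexStarModule in
/-- The `*`-homomorphism extending a real character of the symmetric part. -/
noncomputable def extendChar (f : selfAdjoint R →ₐ[ℝ] ℝ) : Char R where
  toFun a := f (ℜ a) + f (ℑ a) * Complex.I
  map_one' := by
    have : ℑ (1 : R) = 0 := (IsSelfAdjoint.one R).imaginaryPart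
    simp [this, realPart_one]
  map_mul' a b := by
    rw [realPart_mul, imaginaryPart_mul]
    simp only [map_sub, map_add, map_mul, Complex.ofReal_sub, Complex.ofReal_add,
      Complex.ofReal_mul]
    linear_combination -(f (ℑ a) * f (ℑ b) : ℂ) * Complex.I_mul_I
  map_zero' := by simp
  map_add' a b := by
    simp only [map_add, Complex.ofReal_add]
    ring
  commutes' z := by
    have h1 : ℑ (1 : R) = 0 := (IsSelfAdjoint.one R).imaginaryPart
    have h2 : ℜ (1 : R) = 1 := realPart_one
    rw [Algebra.algebraMap_eq_smul_one, realPart_smul, imaginaryPart_smul, h1, h2]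
    simp [Complex.re_add_im]
  map_star' a := by
    have h1 : ℜ (star a) = ℜ a := Subtype.ext (by simp [realPart_apply_coe, add_comm])
    have h2 : ℑ (star a) = -ℑ a := Subtype.ext (by
      rw [NegMemClass.coe_neg, imaginaryPart_apply_coe, imaginaryPart_apply_coe, star_star,
        ← smul_neg, ← smul_neg, neg_sub])
    rw [h1, h2]
    simp

theorem extendChar_coe (f : selfAdjoint R →ₐ[ℝ] ℝ) (a : selfAdjoint R) :
    extendChar f (a : R) = f a := by
  change (f _ + f _ * Complex.I : ℂ) = _
  simp [selfAdjoint.realPart_coe, selfAdjoint.imaginaryPart_coe]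

theorem norm_extendChar_le (f : selfAdjoint R →ₐ[ℝ] ℝ) (a : R) :
    ‖extendChar f a‖ ≤ |f (realPart a)| + |f (imaginaryPart a)| := by
  refine (norm_add_le _ _).trans ?_
  simp [Complex.norm_real]

/-- Real-valued evaluation of the symmetric elements at the characters. -/
noncomputable def evalAlgHom : selfAdjoint R →ₐ[ℝ] C(Char R, ℝ) where
  toFun a := ⟨fun α => (α (a : R)).re, Complex.continuous_re.comp (continuous_char_apply _)⟩
  map_one' := by ext; simp
  map_mul' a b := by
    ext α
    change (α ((a * b : selfAdjoint R) : R)).re = (α (a : R)).re * (α (b : R)).re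
    rw [selfAdjoint.val_mul, map_mul, ← ofReal_re_char_apply α a, ← ofReal_re_char_apply α b,
      ← Complex.ofReal_mul]
    simp only [Complex.ofReal_re]
  map_zero' := by ext; simp
  map_add' a b := by ext; simp
  commutes' r := by
    ext α
    rw [Algebra.algebraMap_eq_smul_one, Algebra.algebraMap_eq_smul_one]
    change (α ((r • 1 : selfAdjoint R) : R)).re = _
    rw [selfAdjoint.val_smul, selfAdjoint.val_one, ← Complex.coe_smul, map_smul, map_one]
    simp

theorem char_ext_of_re {α β : Char R} (h : ∀ a : selfAdjoint R, (α (a : R)).re = (β (a : R)).re) :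
    α = β := by
  have h' : ∀ a : selfAdjoint R, α (a : R) = β (a : R) := fun a => by
    rw [← ofReal_re_char_apply, h, ofReal_re_char_apply]
  ext a
  rw [← realPart_add_I_smul_imaginaryPart a, map_add, map_add, map_smul, map_smul, h', h']

end Character

/-! ### The Gelfand spectrum and the closure formula. -/

section Seminorm

variable {R : Type*} [CommRing R] [StarRing R] [Algebra ℂ R] {φ : Seminorm ℂ R}

omit [StarRing R] in
theorem continuous_seminormTopology_iff (f : R →ₗ[ℂ] ℂ) :
    Continuous[seminormTopology φ, inferInstance] (fun a : R => f a) ↔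
      ∃ C, ∀ a, ‖f a‖ ≤ C * φ a := by
  let : SeminormedAddCommGroup R := φ.toAddGroupSeminorm.toSeminormedAddCommGroup
  let : NormedSpace ℂ R := ⟨fun z a => (map_smul_eq_mul φ z a).le⟩
  refine ⟨fun h => ⟨_, (⟨f, h⟩ : R →L[ℂ] ℂ).le_opNorm⟩, fun ⟨C, hC⟩ => ?_⟩
  exact AddMonoidHomClass.continuous_of_bound f C hC

/-- Exponents start at one because `φ 1 ≤ 1` is not assumed. -/
theorem IsSubmulStarSeminorm.pow_succ_le (hφ : IsSubmulStarSeminorm φ) (a : R) (n : ℕ) :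
    φ (a ^ (n + 1)) ≤ φ a ^ (n + 1) := by
  induction n with
  | zero => simp
  | succ n ih =>
    rw [pow_succ, pow_succ (φ a)]
    exact (hφ.mul_le _ _).trans (by gcongr)

/-- The continuity constant can be taken to be `1`: apply the bound to powers of `a` and let the
exponent grow. -/
theorem IsSubmulStarSeminorm.mem_gelfandSpectrum_iff (hφ : IsSubmulStarSeminorm φ) {α : Char R} :
    α ∈ gelfandSpectrum φ ↔ ∀ a, ‖α a‖ ≤ φ a := by
  refine (continuous_seminormTopology_iff (φ := φ) α.toAlgHom.toLinearMap).trans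
    ⟨fun ⟨C, hC⟩ a => ?_, fun h => ⟨1, by simpa using h⟩⟩
  replace hC : ∀ a, ‖α a‖ ≤ C * φ a := hC
  by_contra! ha
  have h0 : 0 < ‖α a‖ := (apply_nonneg φ a).trans_lt ha
  have hlim : Filter.Tendsto (fun n : ℕ => C * (φ a / ‖α a‖) ^ (n + 1)) Filter.atTop (𝓝 (C * 0)) :=
    ((tendsto_pow_atTop_nhds_zero_of_lt_one (div_nonneg (apply_nonneg φ a) h0.le)
      ((div_lt_one h0).2 ha)).comp (Filter.tendsto_add_atTop_nat 1)).const_mul C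
  have hC0 : 0 ≤ C := by
    by_contra! hneg
    have := hC a
    nlinarith [apply_nonneg φ a]
  have hle : ∀ n : ℕ, 1 ≤ C * (φ a / ‖α a‖) ^ (n + 1) := fun n => by
    rw [div_pow, ← mul_div_assoc, one_le_div (by positivity), ← norm_pow, ← map_pow]
    exact (hC _).trans (mul_le_mul_of_nonneg_left (hφ.pow_succ_le a n) hC0)
  have := ge_of_tendsto' hlim hle
  norm_num at this

theorem IsSubmulStarSeminorm.isCompact_gelfandSpectrum (hφ : IsSubmulStarSeminorm φ) :
    IsCompact (gelfandSpectrum φ) := by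
  have hind : IsInducing (fun (α : Char R) (a : R) => α a) := ⟨rfl⟩
  rw [hind.isCompact_iff]
  have himage : (fun (α : Char R) (a : R) => α a) '' gelfandSpectrum φ =
      {f | f 1 = 1 ∧ (∀ a b, f (a * b) = f a * f b) ∧ (∀ a b, f (a + b) = f a + f b) ∧
        (∀ z : ℂ, f (algebraMap ℂ R z) = z) ∧ (∀ a, f (star a) = star (f a)) ∧
        ∀ a, ‖f a‖ ≤ φ a} := by
    ext f
    constructor
    · rintro ⟨α, hα, rfl⟩
      exact ⟨map_one α, map_mul α, map_add α, fun z => AlgHomClass.commutes α z, map_star α,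
        hφ.mem_gelfandSpectrum_iff.1 hα⟩
    · rintro ⟨h1, hmul, hadd, halg, hstar, hle⟩
      let α : Char R :=
        { toFun := f, map_one' := h1, map_mul' := hmul, map_add' := hadd, commutes' := halg,
          map_star' := hstar, map_zero' := by simpa using hadd 0 0 }
      exact ⟨α, hφ.mem_gelfandSpectrum_iff.2 hle, rfl⟩
  rw [himage]
  refine (isCompact_univ_pi fun a : R => isCompact_closedBall (0 : ℂ) (φ a)).of_isClosed_subset ?_
    fun f hf a _ => mem_closedBall_zero_iff.2 (hf.2.2.2.2.2 a)
  simp only [Set.ofPred_and, Set.ofPred_forall]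
  refine .inter ?_ (.inter ?_ (.inter ?_ (.inter ?_ (.inter ?_ ?_))))
  · exact isClosed_eq (by fun_prop) (by fun_prop)
  · exact isClosed_iInter fun x => isClosed_iInter fun y => isClosed_eq (by fun_prop) (by fun_prop)
  · exact isClosed_iInter fun x => isClosed_iInter fun y => isClosed_eq (by fun_prop) (by fun_prop)
  · exact isClosed_iInter fun x => isClosed_eq (by fun_prop) (by fun_prop)
  · exact isClosed_iInter fun x => isClosed_eq (by fun_prop) (by fun_prop)
  · exact isClosed_iInter fun x => isClosed_le (by fun_prop) (by fun_prop)

theorem isClosed_nonnegSet (S : Set (selfAdjoint R)) : IsClosed (nonnegSet S) := by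
  simp only [nonnegSet, Set.ofPred_forall]
  exact isClosed_iInter fun a => isClosed_iInter fun _ =>
    isClosed_le continuous_const (continuous_char_apply _)

variable [StarModule ℂ R]

/-- The symmetric part as a seminormed ring. -/
@[reducible]
noncomputable def IsSubmulStarSeminorm.seminormedCommRing (hφ : IsSubmulStarSeminorm φ) :
    SeminormedCommRing (selfAdjoint R) :=
  letI : SeminormedAddCommGroup R := φ.toAddGroupSeminorm.toSeminormedAddCommGroup
  { SeminormedAddCommGroup.induced (selfAdjoint R) R (selfAdjoint R).subtype,
    (inferInstance : CommRing (selfAdjoint R)) with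
    norm_mul_le := fun a b => hφ.mul_le a b }

/-- The symmetric part as a real seminormed algebra. -/
@[reducible]
noncomputable def IsSubmulStarSeminorm.normedAlgebra (hφ : IsSubmulStarSeminorm φ) :
    @NormedAlgebra ℝ (selfAdjoint R) _ hφ.seminormedCommRing.toSeminormedRing :=
  letI := hφ.seminormedCommRing
  { (selfAdjointAlgebra : Algebra ℝ (selfAdjoint R)) with
    norm_smul_le := fun r a => by
      change φ ((r • a : selfAdjoint R) : R) ≤ ‖r‖ * φ a
      rw [selfAdjoint.val_smul, ← Complex.coe_smul, map_smul_eq_mul, Complex.norm_real] }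

/-- A separating real character extends to `R`; it stays `φ`-continuous because real and imaginary
parts do not increase `φ`. -/
theorem IsSubmulStarSeminorm.posSet_subset_symmClosure (hφ : IsSubmulStarSeminorm φ) {d : ℕ}
    (hd : 1 ≤ d) {S : Set (selfAdjoint R)} (hS : IsEvenPowerModule d S) :
    posSet (nonnegSet S ∩ gelfandSpectrum φ) ⊆ symmClosure φ S := by
  let := hφ.seminormedCommRing
  let := hφ.normedAlgebra
  intro a ha
  by_contra hcl
  obtain ⟨f, hf, hfS, hfa⟩ :=
    (hS.topologicalClosure).exists_algHom_neg hd isClosed_closure (a := a) hcl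
  obtain ⟨C, hC0, hC⟩ : ∃ C, 0 < C ∧ ∀ x : selfAdjoint R, |f x| ≤ C * φ x :=
    SemilinearMapClass.bound_of_continuous (f : selfAdjoint R →ₗ[ℝ] ℝ) hf
  have hmem : extendChar f ∈ nonnegSet S ∩ gelfandSpectrum φ := by
    constructor
    · intro s hs
      rw [extendChar_coe, Complex.zero_le_real]
      exact hfS s (subset_closure hs)
    · refine (continuous_seminormTopology_iff (extendChar f).toAlgHom.toLinearMap).2
        ⟨2 * C, fun x => (norm_extendChar_le f x).trans ?_⟩
      have h1 : φ (realPart x : R) ≤ φ x := by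
        rw [realPart_apply_coe, ← Complex.coe_smul, map_smul_eq_mul]
        have := map_add_le_add φ x (star x)
        rw [hφ.star_eq] at this
        norm_num
        linarith
      have h2 : φ (imaginaryPart x : R) ≤ φ x := by
        rw [imaginaryPart_apply_coe, ← Complex.coe_smul, map_smul_eq_mul, map_smul_eq_mul]
        have := map_sub_le_add φ x (star x)
        rw [hφ.star_eq] at this
        norm_num
        linarith
      have := (hC (realPart x)).trans (mul_le_mul_of_nonneg_left h1 hC0.le)
      have := (hC (imaginaryPart x)).trans (mul_le_mul_of_nonneg_left h2 hC0.le)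
      linarith
  have := ha _ hmem
  rw [extendChar_coe, Complex.zero_le_real] at this
  exact hfa.not_ge this

omit [StarModule ℂ R] in
/-- A `φ`-continuous function that is nonnegative on `S` is nonnegative on the closure of `S`. -/
theorem apply_nonneg_of_mem_symmClosure {S : Set (selfAdjoint R)} {f : R → ℂ}
    (hf : Continuous[seminormTopology φ, inferInstance] f)
    (hfS : ∀ s ∈ S, 0 ≤ f (s : R)) {a : selfAdjoint R} (ha : a ∈ symmClosure φ S) :
    0 ≤ f (a : R) := by
  let : TopologicalSpace R := seminormTopology φ
  have hcl : IsClosed {x : selfAdjoint R | 0 ≤ f (x : R)} :=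
    isClosed_le continuous_const (hf.comp continuous_subtype_val)
  exact closure_minimal hfS hcl ha

theorem IsSubmulStarSeminorm.symmClosure_eq (hφ : IsSubmulStarSeminorm φ) {d : ℕ}
    (hd : 1 ≤ d) {S : Set (selfAdjoint R)} (hS : IsEvenPowerModule d S) :
    symmClosure φ S = posSet (nonnegSet S ∩ gelfandSpectrum φ) :=
  Set.Subset.antisymm
    (fun _ ha _ hα => apply_nonneg_of_mem_symmClosure hα.2 hα.1 ha)
    (hφ.posSet_subset_symmClosure hd hS)

end Seminorm

end StarMoment

namespace StarMoment

/-! ### Representation and determinacy of measures on compact sets. -/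

section Compact

open scoped CompactlySupported

/-- A functional on a space of continuous functions on a compact space that is nonnegative on the
nonnegative functions of the space is represented by a measure. -/
theorem exists_measure_of_nonneg {X E : Type*} [TopologicalSpace X] [T2Space X] [CompactSpace X]
    [MeasurableSpace X] [BorelSpace X] [AddCommGroup E] [Module ℝ E] (ev : E →ₗ[ℝ] C(X, ℝ))
    {e : E} (he : ev e = 1) (l : E →ₗ[ℝ] ℝ) (hl : ∀ a, 0 ≤ ev a → 0 ≤ l a) :
    ∃ μ : Measure X, μ.Regular ∧ IsFiniteMeasure μ ∧ ∀ a, ∫ x, ev a x ∂μ = l a := by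
  -- A linear section transports `l` to the range of `ev`; by `hker` the choice is immaterial.
  obtain ⟨g, hg⟩ := ev.rangeRestrict.exists_rightInverse_of_surjective ev.range_rangeRestrict
  have hg' : ∀ y : LinearMap.range ev, ev (g y) = y := fun y =>
    congrArg Subtype.val (LinearMap.congr_fun hg y)
  have hker : ∀ a b, ev a = ev b → l a = l b := fun a b hab => by
    have h1 := hl (a - b) (by rw [map_sub, hab, sub_self])
    have h2 := hl (b - a) (by rw [map_sub, hab, sub_self])
    rw [map_sub] at h1 h2
    linarith
  obtain ⟨F, hF, hFpos⟩ := riesz_extension (PointedCone.positive ℝ C(X, ℝ))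
    ⟨LinearMap.range ev, l ∘ₗ g⟩
    (fun y hy => hl _ (by rw [hg' y]; exact hy))
    -- Riesz extension needs the range to dominate every function; the constant `‖y‖` does so.
    (fun y => ⟨⟨ev (‖y‖ • e), ⟨_, rfl⟩⟩, fun x => by
      have := (abs_le.1 (y.norm_coe_le_norm x)).1
      simp only [map_smul, he]
      simp
      linarith⟩)
  have hF' : ∀ a, F (ev a) = l a := fun a => by
    refine (hF ⟨ev a, ⟨a, rfl⟩⟩).trans (hker _ _ (hg' _))
  let Λ : C_c(X, ℝ) →ₚ[ℝ] ℝ := PositiveLinearMap.mk₀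
    { toFun := fun f => F f.toContinuousMap
      map_add' := fun f g => map_add F f.toContinuousMap g.toContinuousMap
      map_smul' := fun r f => map_smul F r f.toContinuousMap }
    (fun f hf => hFpos _ hf)
  refine ⟨RealRMK.rieszMeasure Λ, inferInstance, inferInstance, fun a => ?_⟩
  rw [← hF']
  exact RealRMK.integral_rieszMeasure Λ ⟨ev a, HasCompactSupport.of_compactSpace _⟩

/-- Finite inner regular measures carried by a compact set are determined by the integrals of a
point separating algebra of functions. -/
theorem ext_of_integral_eq_of_separatesPoints {X : Type*} [TopologicalSpace X] [T2Space X]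
    [MeasurableSpace X] [BorelSpace X] {μ ν : Measure X} [IsFiniteMeasure μ] [IsFiniteMeasure ν]
    [μ.InnerRegular] [ν.InnerRegular] {K : Set X} (hK : IsCompact K) (hμ : K ∈ ae μ)
    (hν : K ∈ ae ν) (A : Subalgebra ℝ C(X, ℝ)) (hA : A.SeparatesPoints)
    (h : ∀ g ∈ A, ∫ x, g x ∂μ = ∫ x, g x ∂ν) : μ = ν := by
  have : CompactSpace K := isCompact_iff_compactSpace.1 hK
  have hemb : MeasurableEmbedding (Subtype.val : K → X) :=
    MeasurableEmbedding.subtype_coe hK.measurableSet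
  have hmap : ∀ ρ : Measure X, K ∈ ae ρ → (ρ.comap (Subtype.val : K → X)).map Subtype.val = ρ :=
    fun ρ hρ => by
      rw [map_comap_subtype_coe hK.measurableSet]
      exact Measure.restrict_eq_self_of_ae_mem hρ
  have hfin : ∀ ρ : Measure X, IsFiniteMeasure ρ →
      IsFiniteMeasure (ρ.comap (Subtype.val : K → X)) := fun ρ _ => inferInstance
  have hreg : ∀ ρ : Measure X, IsFiniteMeasure ρ → ρ.InnerRegular →
      (ρ.comap (Subtype.val : K → X)).Regular := fun ρ _ hρ => by
    have : (ρ.comap (Subtype.val : K → X)).InnerRegular :=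
      ⟨hρ.innerRegular.comap hemb (fun _ hU => hemb.measurableSet_image' hU)
        (fun _ hr hc => IsInducing.subtypeVal.isCompact_preimage' hc hr)⟩
    infer_instance
  have hint : ∀ ρ : Measure X, K ∈ ae ρ → ∀ g : C(X, ℝ),
      ∫ x : K, g x ∂(ρ.comap Subtype.val) = ∫ x, g x ∂ρ := fun ρ hρ g => by
    rw [← hemb.integral_map (fun x => g x), hmap ρ hρ]
  have := hreg μ inferInstance inferInstance
  have := hreg ν inferInstance inferInstance
  let B : Subalgebra ℝ C(K, ℝ) := A.map
    (ContinuousMap.compRightAlgHom ℝ ℝ (⟨Subtype.val, continuous_subtype_val⟩ : C(K, X)))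
  have hB : B.SeparatesPoints := fun x y hxy => by
    obtain ⟨_, ⟨f, hf, rfl⟩, hfxy⟩ := hA (Subtype.coe_injective.ne hxy)
    exact ⟨_, ⟨_, ⟨f, hf, rfl⟩, rfl⟩, hfxy⟩
  have hcont : ∀ ρ : Measure K, IsFiniteMeasure ρ →
      Continuous fun g : C(K, ℝ) => ∫ x, g x ∂ρ := fun ρ _ => by
    let I : C(K, ℝ) →ₗ[ℝ] ℝ :=
      { toFun := fun g => ∫ x, g x ∂ρ
        map_add' := fun g g' => integral_add (g.continuous.integrable_of_hasCompactSupport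
          (HasCompactSupport.of_compactSpace _)) (g'.continuous.integrable_of_hasCompactSupport
          (HasCompactSupport.of_compactSpace _))
        map_smul' := fun c g => integral_smul c _ }
    refine AddMonoidHomClass.continuous_of_bound I (ρ.real Set.univ) fun g => ?_
    rw [mul_comm]
    exact norm_integral_le_of_norm_le_const (Filter.Eventually.of_forall g.norm_coe_le_norm)
  have hall : ∀ g : C(K, ℝ), ∫ x, g x ∂(μ.comap Subtype.val) = ∫ x, g x ∂(ν.comap Subtype.val) := by
    intro g
    -- Stone–Weierstrass on `K`: both integrals are sup-norm continuous and agree on the dense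
    -- subalgebra `B`.
    have hg := ContinuousMap.continuousMap_mem_subalgebra_closure_of_separatesPoints B hB g
    refine closure_minimal (s := (B : Set C(K, ℝ))) ?_
      (isClosed_eq (hcont _ (hfin μ inferInstance)) (hcont _ (hfin ν inferInstance))) hg
    rintro _ ⟨f, hf, rfl⟩
    exact (hint μ hμ f).trans ((h f hf).trans (hint ν hν f).symm)
  rw [← hmap μ hμ, ← hmap ν hν]
  congr 1
  exact Measure.ext_of_integral_eq_on_compactlySupported fun f => hall f.toContinuousMap

end Compact

end StarMoment

namespace StarMoment

/-! ### Support, uniqueness and existence of representing measures. -/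

section Moment

variable {R : Type*} [CommRing R] [StarRing R] [Algebra ℂ R] {φ : Seminorm ℂ R} {L : R →ₗ[ℂ] ℂ}

theorem Represents.isFiniteMeasure {μ : Measure (Char R)} (h : Represents μ L) :
    IsFiniteMeasure μ := by
  have := (h 1).1
  simp only [map_one] at this
  exact (integrable_const_iff_isFiniteMeasure one_ne_zero).1 this

/-- Markov's inequality for `(star a * a) ^ (n + 1)`, whose integral is controlled by the continuity
of `L`. For `r > φ a`, letting `n` grow forces the tail to be null. -/
theorem Represents.pow_mul_measureReal_le {μ : Measure (Char R)} (h : Represents μ L)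
    (hφ : IsSubmulStarSeminorm φ) {C : ℝ} (hC : ∀ a, ‖L a‖ ≤ C * φ a) (a : R) {r : ℝ}
    (hr : 0 ≤ r) (n : ℕ) :
    (r ^ 2) ^ (n + 1) * μ.real {α | r ≤ ‖α a‖} ≤ |C| * (φ a ^ 2) ^ (n + 1) := by
  have := h.isFiniteMeasure
  set b : R := (star a * a) ^ (n + 1)
  have hb : ∀ α : Char R, α b = (((‖α a‖ ^ 2) ^ (n + 1) : ℝ) : ℂ) := fun α => by
    rw [map_pow, map_mul, map_star, Complex.star_def, ← Complex.normSq_eq_conj_mul_self,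
      Complex.normSq_eq_norm_sq]
    push_cast
    rfl
  have hint : Integrable (fun α : Char R => (‖α a‖ ^ 2) ^ (n + 1)) μ := by
    have := (h b).1.re
    simpa [hb, ← Complex.ofReal_pow] using this
  calc (r ^ 2) ^ (n + 1) * μ.real {α | r ≤ ‖α a‖}
      ≤ (r ^ 2) ^ (n + 1) * μ.real {α : Char R | (r ^ 2) ^ (n + 1) ≤ (‖α a‖ ^ 2) ^ (n + 1)} := by
        refine mul_le_mul_of_nonneg_left (measureReal_mono fun α hα => ?_) (by positivity)
        have hα : r ≤ ‖α a‖ := hα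
        change (r ^ 2) ^ (n + 1) ≤ (‖α a‖ ^ 2) ^ (n + 1)
        gcongr
    _ ≤ ∫ α : Char R, (‖α a‖ ^ 2) ^ (n + 1) ∂μ :=
        mul_meas_ge_le_integral_of_nonneg (Filter.Eventually.of_forall fun _ => by positivity)
          hint _
    _ ≤ ‖L b‖ := by
        rw [(h b).2]
        simp_rw [hb]
        rw [integral_complex_ofReal, Complex.norm_real]
        exact le_abs_self _
    _ ≤ |C| * φ b := (hC b).trans (mul_le_mul_of_nonneg_right (le_abs_self C) (apply_nonneg φ b))
    _ ≤ |C| * (φ a ^ 2) ^ (n + 1) := by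
        gcongr
        refine (hφ.pow_succ_le _ n).trans (pow_le_pow_left₀ (apply_nonneg φ _) ?_ _)
        refine (hφ.mul_le _ _).trans ?_
        rw [hφ.star_eq, sq]

theorem Represents.ae_norm_le {μ : Measure (Char R)} (h : Represents μ L)
    (hφ : IsSubmulStarSeminorm φ) {C : ℝ} (hC : ∀ a, ‖L a‖ ≤ C * φ a) (a : R) :
    ∀ᵐ α ∂μ, ‖α a‖ ≤ φ a := by
  have := h.isFiniteMeasure
  have key : ∀ r : ℝ, φ a < r → μ {α | r ≤ ‖α a‖} = 0 := fun r hr => by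
    have hr0 : 0 < r := (apply_nonneg φ a).trans_lt hr
    have hle : ∀ n : ℕ, μ.real {α | r ≤ ‖α a‖} ≤ |C| * (φ a ^ 2 / r ^ 2) ^ (n + 1) := fun n => by
      rw [div_pow, ← mul_div_assoc, le_div_iff₀ (by positivity), mul_comm]
      exact h.pow_mul_measureReal_le hφ hC a hr0.le n
    have hlim : Filter.Tendsto (fun n : ℕ => |C| * (φ a ^ 2 / r ^ 2) ^ (n + 1)) Filter.atTop
        (𝓝 (|C| * 0)) :=
      ((tendsto_pow_atTop_nhds_zero_of_lt_one (by positivity)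
        ((div_lt_one (by positivity)).2 (pow_lt_pow_left₀ hr (apply_nonneg φ a) two_ne_zero))).comp
          (Filter.tendsto_add_atTop_nat 1)).const_mul |C|
    have h0 := ge_of_tendsto' hlim hle
    rw [mul_zero] at h0
    exact (measureReal_eq_zero_iff).1 (le_antisymm h0 measureReal_nonneg)
  have hall : ∀ᵐ α ∂μ, ∀ k : ℕ, ¬ φ a + 1 / ((k : ℝ) + 1) ≤ ‖α a‖ := by
    rw [ae_all_iff]
    intro k
    have := key (φ a + 1 / ((k : ℝ) + 1)) (lt_add_of_pos_right _ Nat.one_div_pos_of_nat)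
    simpa [ae_iff] using this
  filter_upwards [hall] with α hα
  by_contra! hlt
  obtain ⟨k, hk⟩ := exists_nat_one_div_lt (sub_pos.2 hlt)
  exact hα k (by linarith)

/-- A Radon measure representing a `φ`-continuous functional is carried by the Gelfand spectrum. -/
theorem Represents.gelfandSpectrum_mem_ae {μ : Measure (Char R)} (h : Represents μ L)
    (hμ : IsRadon μ) (hφ : IsSubmulStarSeminorm φ) {C : ℝ} (hC : ∀ a, ‖L a‖ ≤ C * φ a) :
    gelfandSpectrum φ ∈ ae μ := by
  have := hμ.innerRegular
  -- The null sets depend on `a`, and `R` may be uncountable. The support lies in each closed set of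
  -- full measure, and inner regularity makes the support itself conull.
  refine Filter.mem_of_superset (Measure.support_mem_ae_of_innerRegular (μ := μ)) fun α hα =>
    hφ.mem_gelfandSpectrum_iff.2 fun a => ?_
  exact Measure.support_subset_of_isClosed (t := {α : Char R | ‖α a‖ ≤ φ a})
    (isClosed_le (continuous_char_apply a).norm continuous_const) (h.ae_norm_le hφ hC a) hα

variable [StarModule ℂ R]

theorem Represents.integral_evalAlgHom {μ : Measure (Char R)} (h : Represents μ L)
    (a : selfAdjoint R) : ∫ α, evalAlgHom a α ∂μ = (L a).re := by
  rw [(h a).2]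
  exact integral_re (h a).1

theorem Represents.unique {μ ν : Measure (Char R)} (hμL : Represents μ L) (hνL : Represents ν L)
    (hμ : IsRadon μ) (hν : IsRadon ν) (hφ : IsSubmulStarSeminorm φ) {C : ℝ}
    (hC : ∀ a, ‖L a‖ ≤ C * φ a) : μ = ν := by
  have := hμL.isFiniteMeasure
  have := hνL.isFiniteMeasure
  have := hμ.innerRegular
  have := hν.innerRegular
  refine ext_of_integral_eq_of_separatesPoints hφ.isCompact_gelfandSpectrum
    (hμL.gelfandSpectrum_mem_ae hμ hφ hC) (hνL.gelfandSpectrum_mem_ae hν hφ hC)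
    (evalAlgHom (R := R)).range (fun α β hne => ?_) ?_
  · by_contra! hall
    exact hne (char_ext_of_re fun a => hall _ ⟨_, ⟨a, rfl⟩, rfl⟩)
  · rintro _ ⟨a, rfl⟩
    exact (hμL.integral_evalAlgHom a).trans (hνL.integral_evalAlgHom a).symm

/-- Existence of a representing measure on a compact set of characters. -/
theorem exists_isRadon_represents {K : Set (Char R)} (hK : IsCompact K)
    (hstar : ∀ a, L (star a) = star (L a)) (hpos : ∀ a ∈ posSet K, 0 ≤ L (a : R)) :
    ∃ μ : Measure (Char R), IsRadon μ ∧ Represents μ L ∧ K ∈ ae μ := by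
  have : CompactSpace K := isCompact_iff_compactSpace.1 hK
  have hre : ∀ a : selfAdjoint R, (((L a).re : ℝ) : ℂ) = L a := fun a => by
    rw [← Complex.conj_eq_iff_re, ← Complex.star_def, ← hstar, a.2.star_eq]
  let ev : selfAdjoint R →ₗ[ℝ] C(K, ℝ) :=
    ((ContinuousMap.compRightAlgHom ℝ ℝ
      (⟨Subtype.val, continuous_subtype_val⟩ : C(K, Char R))).comp evalAlgHom).toLinearMap
  let l : selfAdjoint R →ₗ[ℝ] ℝ :=
    { toFun := fun a => (L a).re
      map_add' := fun a b => by simp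
      map_smul' := fun r a => by
        rw [selfAdjoint.val_smul, ← Complex.coe_smul, map_smul, smul_eq_mul,
          Complex.re_ofReal_mul, RingHom.id_apply, smul_eq_mul] }
  obtain ⟨ρ, hρ, hfin, hint⟩ := exists_measure_of_nonneg ev
    (e := 1) (map_one ((ContinuousMap.compRightAlgHom ℝ ℝ
      (⟨Subtype.val, continuous_subtype_val⟩ : C(K, Char R))).comp evalAlgHom)) l (fun a ha =>
      (Complex.nonneg_iff.1 (hpos a fun α hα => (nonneg_char_apply_iff α a).2 (ha ⟨α, hα⟩))).1)
  have hcont : ∀ a : R, Continuous fun α : K => (α : Char R) a := fun a =>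
    (continuous_char_apply a).comp continuous_subtype_val
  have hi : ∀ a : R, Integrable (fun α : K => (α : Char R) a) ρ := fun a =>
    (hcont a).integrable_of_hasCompactSupport (HasCompactSupport.of_compactSpace _)
  have hsymm : ∀ a : selfAdjoint R, ∫ α : K, (α : Char R) (a : R) ∂ρ = L a := fun a => by
    rw [← hre a]
    refine Eq.trans ?_ (congrArg Complex.ofReal (hint a))
    rw [← integral_complex_ofReal]
    exact integral_congr_ae (Filter.Eventually.of_forall fun α => (ofReal_re_char_apply _ a).symm)
  have hemb : MeasurableEmbedding (Subtype.val : K → Char R) :=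
    MeasurableEmbedding.subtype_coe hK.measurableSet
  refine ⟨ρ.map Subtype.val, ⟨inferInstance,
    Measure.InnerRegular.map_of_continuous continuous_subtype_val⟩, fun a => ⟨?_, ?_⟩, ?_⟩
  · exact hemb.integrable_map_iff.2 (hi a)
  · rw [hemb.integral_map]
    conv_lhs => rw [← realPart_add_I_smul_imaginaryPart a]
    conv_rhs => rw [← realPart_add_I_smul_imaginaryPart a]
    simp only [map_add, map_smul]
    refine Eq.trans ?_ (integral_add (hi _) ((hi _).smul Complex.I)).symm
    simp only [Pi.smul_apply, integral_smul, hsymm]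
  · rw [mem_ae_iff, hemb.map_apply]
    simp

end Moment

end StarMoment

theorem corollary4p1 {R : Type*} [CommRing R] [StarRing R] [Algebra ℂ R] [StarModule ℂ R]
    (φ : Seminorm ℂ R) (hφ : StarMoment.IsSubmulStarSeminorm φ)
    (d : ℕ) (hd : 1 ≤ d)
    (S : Set (selfAdjoint R)) (hS : StarMoment.IsEvenPowerModule d S) :
    StarMoment.symmClosure φ S =
        StarMoment.posSet (StarMoment.nonnegSet S ∩ StarMoment.gelfandSpectrum φ) ∧
      ∀ L : R →ₗ[ℂ] ℂ,
        (∀ a : R, L (star a) = star (L a)) →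
        Continuous[StarMoment.seminormTopology φ, inferInstance] (fun a : R => L a) →
        (∀ s ∈ S, 0 ≤ L (s : R)) →
        ∃ μ : Measure (StarMoment.Char R),
          (StarMoment.IsRadon μ ∧ StarMoment.Represents μ L) ∧
          μ.support ⊆ StarMoment.nonnegSet S ∩ StarMoment.gelfandSpectrum φ ∧
          ∀ ν : Measure (StarMoment.Char R),
            StarMoment.IsRadon ν → StarMoment.Represents ν L → ν = μ := by
  have hcl := hφ.symmClosure_eq hd hS
  refine ⟨hcl, fun L hstar hL hLS => ?_⟩
  obtain ⟨C, hC⟩ := (StarMoment.continuous_seminormTopology_iff L).1 hL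
  have hK : IsCompact (StarMoment.nonnegSet S ∩ StarMoment.gelfandSpectrum φ) :=
    hφ.isCompact_gelfandSpectrum.inter_left (StarMoment.isClosed_nonnegSet S)
  -- The closure formula turns positivity on `S` into positivity on all of `Pos(K)`.
  obtain ⟨μ, hμ, hμL, hμK⟩ := StarMoment.exists_isRadon_represents hK hstar fun a ha =>
    StarMoment.apply_nonneg_of_mem_symmClosure hL hLS (by rwa [hcl])
  exact ⟨μ, ⟨hμ, hμL⟩, Measure.support_subset_of_isClosed hK.isClosed hμK,
    fun ν hν hνL => hνL.unique hμL hν hμ hφ hC⟩
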